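/- Let $N$ be a smooth Hausdorff manifold without boundary of finite dimension $\dim N\ge 1$, and let $m\ge 1$. Let $F_m(N)\subset N^m$ be the open submanifold of $m$-tuples of pairwise distinct points, let $C_m(N)=F_m(N)/\Sigma_m$ be the unordered $m$-point configuration space, where the symmetric group $\Sigma_m$ permutes the entries, with the smooth structure of the quotient by this free action, and let $\pi:F_m(N)\to C_m(N)$ be the quotient map. Write $H^1$ for first de Rham cohomology (closed smooth $1$-forms modulo differentials of smooth functions). Then there is an injective linear map $\Phi:H^1(N)\to H^1(C_m(N))$ with the following property: for every closed $1$-form $\omega$ on $N$ there is a closed $1$-form $\eta$ on $C_m(N)$ such that $\pi^*\eta=\hat\omega$ and $\Phi([\omega])=[\eta]$, where $\hat\omega=\sum_{i=1}^m \mathrm{pr}_i^*\omega$ is the $\Sigma_m$-invariant $1$-form on $F_m(N)$ given by $\hat\omega_x(v_1,\dots,v_m)=\sum_{i=1}^m\omega_{x_i}(v_i)$ for $x=(x_1,\dots,x_m)\in F_m(N)$ and $v_i\in T_{x_i}N$. -/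

import Mathlib

open scoped Manifold ContDiff Topology Bundle

noncomputable section
namespace DeRham
variable {E : Type*} [NormedAddCommGroup E] [NormedSpace ℝ E] {H : Type*} [TopologicalSpace H]
  (I : ModelWithCorners ℝ E H) (M : Type*) [TopologicalSpace M] [ChartedSpace H M]
  [IsManifold I ∞ M]

/-- Smooth differential `1`-forms on `M`: smooth sections of the cotangent bundle. -/
abbrev OneForm : Type _ :=
  ContMDiffSection I (E →L[ℝ] ℝ) ∞ (fun x : M ↦ TangentSpace I x →L[ℝ] Bundle.Trivial M ℝ x)

variable {I M}

/-- The pullback of a `1`-form to the model vector space along the inverse of the chart at `x`. -/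
def localRep (α : OneForm I M) (x : M) (y : E) : E →L[ℝ] ℝ :=
  (α ((extChartAt I x).symm y)).comp
    (mfderivWithin 𝓘(ℝ, E) I (extChartAt I x).symm (Set.range I) y)

/-- The exterior derivative of a `1`-form at `x`, computed in the chart at `x`. No further pullback is
needed, since the tangent space at `x` is the model space, identified through the chart at `x`. -/
def extDerivAt (α : OneForm I M) (x : M) : TangentSpace I x [⋀^Fin 2]→L[ℝ] ℝ :=
  (extDerivWithin
    (fun y : E ↦ ContinuousAlternatingMap.ofSubsingleton ℝ E ℝ (0 : Fin 1) (localRep α x y))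
    (Set.range I) (extChartAt I x x) : E [⋀^Fin 2]→L[ℝ] ℝ)

theorem localRep_differentiable (α : OneForm I M) (x : M) :
    DifferentiableWithinAt ℝ (localRep α x) (Set.range I) (extChartAt I x x) := by
  have h2 := ((contMDiffAt_hom_bundle _).1 (α.contMDiff x)).2
  rw [contMDiffAt_iff] at h2
  have h3 := h2.2.differentiableWithinAt (by simp)
  have key : ∀ y ∈ (extChartAt I x).target, localRep α x y =
     (ContinuousLinearMap.inCoordinates E (TangentSpace I) ℝ (Bundle.Trivial M ℝ) x
      ((extChartAt I x).symm y) x ((extChartAt I x).symm y) (α ((extChartAt I x).symm y))) := by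
    intro y hy
    have hy' := (extChartAt I x).map_target hy
    rw [extChartAt_source] at hy'
    rw [ContinuousLinearMap.inCoordinates, TangentBundle.symmL_trivializationAt hy',
      (extChartAt I x).right_inv hy]
    ext v
    simp [localRep]
  refine h3.congr_of_eventuallyEq ?_ ?_
  · filter_upwards [extChartAt_target_mem_nhdsWithin x] with y hy using key y hy
  · exact key _ (mem_extChartAt_target x)

theorem ofSubsingleton_differentiable (α : OneForm I M) (x : M) :
    DifferentiableWithinAt ℝ (fun y : E ↦
      ContinuousAlternatingMap.ofSubsingleton ℝ E ℝ (0 : Fin 1) (localRep α x y))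
      (Set.range I) (extChartAt I x x) :=
  ((ContinuousAlternatingMap.ofSubsingletonLIE (𝕜 := ℝ) (E := E) (F := ℝ)
    (0 : Fin 1)).differentiable _).comp_differentiableWithinAt _ (localRep_differentiable α x)

theorem localRep_add (α β : OneForm I M) (x : M) (y : E) :
    localRep (α + β) x y = localRep α x y + localRep β x y := rfl

theorem localRep_smul (c : ℝ) (α : OneForm I M) (x : M) (y : E) :
    localRep (c • α) x y = c • localRep α x y := rfl

variable (I M) in
/-- The exterior derivative on `1`-forms. -/
def dOne : OneForm I M →ₗ[ℝ] (x : M) → TangentSpace I x [⋀^Fin 2]→L[ℝ] ℝ where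
  toFun α := extDerivAt α
  map_add' α β := by
    funext x
    exact extDerivWithin_add (I.uniqueDiffOn _ (by simp))
      (ofSubsingleton_differentiable α x) (ofSubsingleton_differentiable β x)
  map_smul' c α := by
    funext x
    exact extDerivWithin_smul (𝕜 := ℝ) (E := E) (F := ℝ) (n := 1) c
      (fun y ↦ ContinuousAlternatingMap.ofSubsingleton ℝ E ℝ (0 : Fin 1) (localRep α x y))
      (I.uniqueDiffOn (extChartAt I x x) (by simp))

theorem contMDiff_mfderiv (f : C^∞⟮I, M; ℝ⟯) :
    ContMDiff I (I.prod 𝓘(ℝ, E →L[ℝ] ℝ)) ∞ (fun x ↦ Bundle.TotalSpace.mk' (E →L[ℝ] ℝ)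
      (E := fun x : M ↦ TangentSpace I x →L[ℝ] Bundle.Trivial M ℝ x) x
        (mfderiv I 𝓘(ℝ, ℝ) f x)) := by
  intro x
  rw [contMDiffAt_hom_bundle]
  refine ⟨contMDiffAt_id, ?_⟩
  have := (f.contMDiff x).mfderiv_const (m := ∞) (by simp)
  convert this using 2 with y
  ext v
  simp [inTangentCoordinates, ContinuousLinearMap.inCoordinates]
  rfl

variable (I M) in
/-- The exterior derivative on smooth functions. -/
def dZero : C^∞⟮I, M; ℝ⟯ →ₗ[ℝ] OneForm I M where
  toFun f := ⟨fun x ↦ mfderiv I 𝓘(ℝ, ℝ) f x, contMDiff_mfderiv f⟩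
  map_add' f g := by
    ext x : 1
    exact mfderiv_add (f.contMDiff.mdifferentiable (by simp) x)
      (g.contMDiff.mdifferentiable (by simp) x)
  map_smul' c f := by
    ext x : 1
    exact const_smul_mfderiv (f.contMDiff.mdifferentiable (by simp) x) c

variable (I M) in
/-- The closed `1`-forms. -/
abbrev ClosedOneForm : Submodule ℝ (OneForm I M) := LinearMap.ker (dOne I M)

variable (I M) in
/-- The first de Rham cohomology: closed `1`-forms modulo the exact ones. -/
abbrev H1 : Type _ :=
  ClosedOneForm I M ⧸ (LinearMap.range (dZero I M)).submoduleOf (ClosedOneForm I M)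

/-- The cohomology class of a closed `1`-form. -/
def H1.mk : ClosedOneForm I M →ₗ[ℝ] H1 I M := Submodule.mkQ _

end DeRham

namespace Conf

section Pi
variable {ι : Type*} [Fintype ι] {E : Type*} [NormedAddCommGroup E] [NormedSpace ℝ E]
  {N : Type*} [TopologicalSpace N] [ChartedSpace E N]

/-- The model of the product of finitely many copies of a manifold modelled on `E`. -/
abbrev piModel (ι : Type*) [Fintype ι] (E : Type*) [NormedAddCommGroup E] [NormedSpace ℝ E] :
    ModelWithCorners ℝ (ι → E) (ModelPi fun _ : ι ↦ E) :=
  ModelWithCorners.pi fun _ : ι ↦ 𝓘(ℝ, E)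

instance : (piModel ι E).Boundaryless :=
  ⟨Set.eq_univ_of_forall fun y ↦ ⟨y, rfl⟩⟩

instance [IsManifold 𝓘(ℝ, E) ∞ N] : IsManifold (piModel ι E) ∞ (ι → N) := by
  apply isManifold_of_contDiffOn
  rintro _ _ ⟨e, he, rfl⟩ ⟨e', he', rfl⟩
  rw [contDiffOn_pi]
  intro i
  have h1 := (contDiffGroupoid ∞ 𝓘(ℝ, E)).compatible (he i trivial) (he' i trivial)
  rw [contDiffGroupoid, mem_groupoid_of_pregroupoid] at h1
  have h2 : ContDiffOn ℝ ∞ ((e i).symm ≫ₕ e' i) ((e i).symm ≫ₕ e' i).source := by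
    simpa [contDiffPregroupoid] using h1.1
  have h3 : ContDiff ℝ ∞ (fun y : ι → E ↦ y i) := contDiff_apply ℝ E i
  refine (h2.comp h3.contDiffOn ?_)
  rintro y ⟨⟨hy1, hy2⟩, -⟩
  exact ⟨hy1 i trivial, hy2 i trivial⟩

theorem contMDiff_eval [IsManifold 𝓘(ℝ, E) ∞ N] (i : ι) :
    ContMDiff (piModel ι E) 𝓘(ℝ, E) ∞ (fun x : ι → N ↦ x i) := by
  intro x
  rw [contMDiffAt_iff]
  refine ⟨(continuous_apply i).continuousAt, ?_⟩
  have h3 : ContDiff ℝ ∞ (fun y : ι → E ↦ y i) := contDiff_apply ℝ E i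
  refine h3.contDiffAt.contDiffWithinAt.congr_of_eventuallyEq ?_ ?_
  · filter_upwards [extChartAt_target_mem_nhdsWithin (I := piModel ι E) x] with y hy
    have : y i ∈ (extChartAt 𝓘(ℝ, E) (x i)).target := ⟨trivial, hy.2 i trivial⟩
    exact (extChartAt 𝓘(ℝ, E) (x i)).right_inv this
  · exact (extChartAt 𝓘(ℝ, E) (x i)).right_inv (mem_extChartAt_target (x i))

theorem contMDiff_pi_of {F G X : Type*} [NormedAddCommGroup F] [NormedSpace ℝ F]
    [TopologicalSpace G] {J : ModelWithCorners ℝ F G} [TopologicalSpace X] [ChartedSpace G X]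
    {f : X → ι → N}
    (h : ∀ i, ContMDiff J 𝓘(ℝ, E) ∞ (fun x ↦ f x i)) : ContMDiff J (piModel ι E) ∞ f := by
  intro x
  rw [contMDiffAt_iff]
  refine ⟨(continuous_pi fun i ↦ (h i).continuous).continuousAt, ?_⟩
  rw [contDiffWithinAt_pi]
  intro i
  exact (contMDiffAt_iff.1 (h i x)).2
end Pi

variable (m : ℕ) (N : Type*) [TopologicalSpace N] [T2Space N]

/-- The ordered `m`-tuples of pairwise distinct points of `N`, an open subset of `N ^ m`. -/
def ordConf : TopologicalSpace.Opens (Fin m → N) where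
  carrier := {x | Function.Injective x}
  is_open' := by
    have : {x : Fin m → N | Function.Injective x} =
        ⋂ i, ⋂ j, {x | i ≠ j → x i ≠ x j} := by
      ext x
      simp only [Set.mem_iInter, Set.mem_ofPred_eq]
      exact ⟨fun h i j hij he ↦ hij (h he), fun h i j he ↦ by_contra fun hij ↦ h i j hij he⟩
    rw [this]
    refine isOpen_iInter_of_finite fun i ↦ isOpen_iInter_of_finite fun j ↦ ?_
    by_cases hij : i = j
    · simp [hij]
    · simpa [hij] using isOpen_ne_fun (continuous_apply i) (continuous_apply j)

/-- The ordered configuration space, i.e. the embeddings of `m` points into `N`. -/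
abbrev OrdConf : Type _ := ordConf m N

variable {m N}

/-- The symmetric group permutes the labels. -/
instance : MulAction (Equiv.Perm (Fin m)) (OrdConf m N) where
  smul σ x := ⟨fun i ↦ x.1 (σ⁻¹ i), x.2.comp (σ⁻¹).injective⟩
  one_smul _ := rfl
  mul_smul _ _ _ := rfl

theorem smul_val (σ : Equiv.Perm (Fin m)) (x : OrdConf m N) (i : Fin m) :
    (σ • x).1 i = x.1 (σ⁻¹ i) := rfl

instance : ContinuousConstSMul (Equiv.Perm (Fin m)) (OrdConf m N) where
  continuous_const_smul σ := by
    have h : Continuous fun x : OrdConf m N ↦ (σ • x).1 :=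
      continuous_pi fun i ↦ (continuous_apply (σ⁻¹ i)).comp continuous_subtype_val
    exact continuous_induced_rng.2 h

instance : IsCancelSMul (Equiv.Perm (Fin m)) (OrdConf m N) where
  right_cancel' σ τ x h := by
    apply inv_injective
    ext i : 1
    exact x.2 (congrFun (congrArg Subtype.val h) i)

variable (m N) in
/-- The unordered `m`-point configuration space: the orbit space, with the quotient topology. -/
abbrev UConf : Type _ := MulAction.orbitRel.Quotient (Equiv.Perm (Fin m)) (OrdConf m N)

/-- The quotient map from ordered to unordered configurations. -/
def proj : OrdConf m N → UConf m N := Quotient.mk _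

variable {E : Type*} [NormedAddCommGroup E] [NormedSpace ℝ E] [ChartedSpace E N]

variable (E) in
theorem locallyCompactSpace_ordConf [FiniteDimensional ℝ E] (N : Type*) [TopologicalSpace N] [T2Space N]
    [ChartedSpace E N] : LocallyCompactSpace (OrdConf m N) :=
  haveI : LocallyCompactSpace N := Manifold.locallyCompact_of_finiteDimensional 𝓘(ℝ, E)
  (ordConf m N).isOpen.locallyCompactSpace

/-- The charts of the quotient manifold: local inverses of the quotient map followed by charts of
the ordered configuration space. -/
instance [FiniteDimensional ℝ E] : ChartedSpace (ModelPi fun _ : Fin m ↦ E) (UConf m N) :=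
  haveI := locallyCompactSpace_ordConf (m := m) E N
  MulAction.instChartedSpaceQuotient

theorem contMDiff_smul [IsManifold 𝓘(ℝ, E) ∞ N] (σ : Equiv.Perm (Fin m)) :
    ContMDiff (piModel (Fin m) E) (piModel (Fin m) E) ∞ (fun x : OrdConf m N ↦ σ • x) := by
  have h : ContMDiff (piModel (Fin m) E) (piModel (Fin m) E) ∞
      (fun x : OrdConf m N ↦ (σ • x).1) :=
    contMDiff_pi_of fun i ↦ (contMDiff_eval (σ⁻¹ i)).comp contMDiff_subtype_val
  exact (ContMDiff.subtypeVal_comp_iff (ordConf m N) fun x ↦ σ • x).mp h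

theorem isManifold_quotient {F G X Y K : Type*} [NormedAddCommGroup F] [NormedSpace ℝ F]
    [TopologicalSpace G] (J : ModelWithCorners ℝ F G) [TopologicalSpace X] [ChartedSpace G X]
    [IsManifold J ∞ X] [TopologicalSpace Y] [Group K] [MulAction K X]
    (hK : ∀ k : K, ContMDiff J J ∞ (fun x : X ↦ k • x)) {p : X → Y} (hp : IsLocalHomeomorph p)
    (hp' : Function.Surjective p) (hpK : ∀ x y, p x = p y ↔ x ∈ MulAction.orbit K y) :
    @IsManifold ℝ _ F _ _ G _ J ∞ Y _ (hp.chartedSpace hp') := by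
  let _ := hp.chartedSpace (H := G) hp'
  apply isManifold_of_contDiffOn
  rintro _ _ ⟨q, rfl⟩ ⟨q', rfl⟩
  generalize hp'.hasRightInverse.choose q = a
  generalize hp'.hasRightInverse.choose q' = a'
  rintro y ⟨⟨⟨hy1, hy2⟩, ⟨hy3, hy4⟩⟩, hy5⟩
  change J.symm y ∈ (chartAt G a).target at hy1
  change (hp.localInverseAt a).symm ((chartAt G a).symm (J.symm y)) ∈
    (hp.localInverseAt a').source at hy3
  change hp.localInverseAt a' ((hp.localInverseAt a).symm ((chartAt G a).symm (J.symm y))) ∈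
    (chartAt G a').source at hy4
  rw [hp.localInverseAt_symm] at hy3 hy4
  have hy1' : y ∈ (extChartAt J a).target := by
    rw [extChartAt_target]; exact ⟨hy1, hy5⟩
  have hcont : ContinuousWithinAt (extChartAt J a).symm (Set.range J) y :=
    (continuousAt_extChartAt_symm'' hy1').continuousWithinAt
  have hx0 : (extChartAt J a).symm y = (chartAt G a).symm (J.symm y) := by simp
  have hx0s : (extChartAt J a).symm y ∈ (chartAt G a).source := by
    simpa using (extChartAt J a).map_target hy1'
  have hyx : extChartAt J a ((extChartAt J a).symm y) = y := (extChartAt J a).right_inv hy1'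
  rw [← hx0] at hy3 hy4
  generalize hx : (extChartAt J a).symm y = x at *
  obtain ⟨k, hk⟩ := (hpK _ _).1 (hp.apply_localInverseAt_of_mem hy3)
  simp only at hk
  have hmain := ((contMDiffAt_iff_of_mem_source hx0s (hk ▸ hy4)).1 (hK k x)).2
  rw [hyx] at hmain
  refine (hmain.congr_of_eventuallyEq ?_ ?_).mono Set.inter_subset_right
  · have h1 := hcont.eventually_mem ((hp.localInverseAt a').open_source.preimage
      hp.continuous |>.mem_nhds (by rw [hx]; exact hy3))
    have h2 := hcont.eventually_mem ((hp.localInverseAt a').open_target.preimage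
      (hK k).continuous |>.mem_nhds (by
        rw [hx, Set.mem_preimage, hk]; exact (hp.localInverseAt a').map_source hy3))
    filter_upwards [h1, h2] with z hz1 hz2
    have : hp.localInverseAt a' (p ((extChartAt J a).symm z)) = k • (extChartAt J a).symm z := by
      refine hp.injOn_localInverseAt_target ((hp.localInverseAt a').map_source hz1) hz2 ?_
      rw [hp.apply_localInverseAt_of_mem hz1, eq_comm, hpK]
      exact ⟨k, rfl⟩
    simp only [Function.comp, ← this]
    simp
  · simp only [Function.comp, hx, hk]
    simp [← hx0]

instance [FiniteDimensional ℝ E] [IsManifold 𝓘(ℝ, E) ∞ N] : IsManifold (piModel (Fin m) E) ∞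
    (UConf m N) :=
  haveI := locallyCompactSpace_ordConf (m := m) E N
  isManifold_quotient _ contMDiff_smul
    isQuotientCoveringMap_quotientMk_of_properlyDiscontinuousSMul.isCoveringMap.isLocalHomeomorph
    Quotient.mk_surjective (fun _ _ ↦ Quotient.eq'')

/-- The form `∑ i, pr_i^* α` on the ordered configuration space: its value at `x` on a tangent vector
`v` is the sum over the `m` points (each of weight one) of `α` at `x i` on the `i`-th component
of `v`. -/
def hat [IsManifold 𝓘(ℝ, E) ∞ N] (α : DeRham.OneForm 𝓘(ℝ, E) N) (x : OrdConf m N) :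
    TangentSpace (piModel (Fin m) E) x →L[ℝ] ℝ :=
  ∑ i, (α (x.1 i)).comp
    (mfderiv (piModel (Fin m) E) 𝓘(ℝ, E) (fun z : OrdConf m N ↦ z.1 i) x)

/-- The pullback to the ordered configuration space of a form on the unordered one. -/
def pullProj [FiniteDimensional ℝ E] [IsManifold 𝓘(ℝ, E) ∞ N]
    (η : DeRham.OneForm (piModel (Fin m) E) (UConf m N)) (x : OrdConf m N) :
    TangentSpace (piModel (Fin m) E) x →L[ℝ] ℝ :=
  (η (proj x)).comp (mfderiv (piModel (Fin m) E) (piModel (Fin m) E) proj x)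

end Conf
end

/-!
By the Poincaré lemma a `1`-form is closed if and only if it is locally exact. If `f i` is a
primitive of `α` near `x i`, then `z ↦ ∑ i, f i (z i)` is a primitive of `hat α` near the
configuration `x`, so `hat α` is locally exact. It is also invariant, hence descends along the local
diffeomorphism `proj` to a locally exact, thus closed, form `η`; and if `α` has a global primitive
`f`, then the sum of `f` over the points of a configuration is a primitive of `η`.

Conversely, let `g` be a global primitive of `η`. Around a point of `N` take a convex chart domain
on which `α` has a primitive `f`. The unordered configurations in this domain form a connected set:
the tuples on which a fixed nonzero linear functional is strictly increasing form a convex set, and,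
up to order, they are dense among all tuples. This holds in dimension one as well, where the ordered
configurations are disconnected. Thus, after adding a constant to `f`, the value of `g` at a
configuration in the domain is the sum of `f` over its points. Letting all the points tend to a
single point `y` shows that `g` determines `f y`, so the local primitives agree on overlaps and glue
to a global primitive of `α`.
-/

noncomputable section

namespace DeRham

section Pullback
variable {E E' E'' H H' H'' M M' M'' : Type*}
  [NormedAddCommGroup E] [NormedSpace ℝ E] [TopologicalSpace H]
  [NormedAddCommGroup E'] [NormedSpace ℝ E'] [TopologicalSpace H']
  [NormedAddCommGroup E''] [NormedSpace ℝ E''] [TopologicalSpace H'']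
  {I : ModelWithCorners ℝ E H} {I' : ModelWithCorners ℝ E' H'} {I'' : ModelWithCorners ℝ E'' H''}
  [TopologicalSpace M] [ChartedSpace H M] [TopologicalSpace M'] [ChartedSpace H' M']
  [TopologicalSpace M''] [ChartedSpace H'' M'']

/-- Covector fields on `M`, that is, sections of the cotangent bundle without any regularity. -/
abbrev CovectorField (I : ModelWithCorners ℝ E H) (M : Type*) [TopologicalSpace M]
    [ChartedSpace H M] : Type _ := ∀ x : M, TangentSpace I x →L[ℝ] ℝ

variable (I I') in
/-- The pullback `p^* β` of a covector field along a map. It is meaningful only at the points where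
`p` is differentiable: elsewhere `mfderiv`, and hence the pullback, is zero. -/
def pullback (p : M → M') (β : CovectorField I' M') : CovectorField I M := fun x ↦
  (β (p x)).comp (mfderiv I I' p x)

theorem pullback_congr {p q : M → M'} {x : M} (h : p =ᶠ[𝓝 x] q) (β : CovectorField I' M') :
    pullback I I' p β x = pullback I I' q β x :=
  congrArg₂ (fun (y : M') (L : E →L[ℝ] E') ↦ (β y : E' →L[ℝ] ℝ).comp L) h.eq_of_nhds h.mfderiv_eq

theorem pullback_id (β : CovectorField I M) : pullback I I id β = β := by
  funext x
  rw [pullback, mfderiv_id]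
  rfl

theorem pullback_comp {p : M' → M''} {q : M → M'} {x : M} (hp : MDifferentiableAt I' I'' p (q x))
    (hq : MDifferentiableAt I I' q x) (β : CovectorField I'' M'') :
    pullback I I'' (p ∘ q) β x = pullback I I' q (pullback I' I'' p β) x := by
  rw [pullback, mfderiv_comp x hp hq]
  rfl

theorem pullback_pullback_of_eventuallyEq_id {p : M' → M} {q : M → M'} {x : M}
    (hp : MDifferentiableAt I' I p (q x)) (hq : MDifferentiableAt I I' q x)
    (h : p ∘ q =ᶠ[𝓝 x] id) (β : CovectorField I M) :
    pullback I I' q (pullback I' I p β) x = β x := by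
  rw [← pullback_comp hp hq, pullback_congr h, pullback_id]

end Pullback

section LocallyExact
variable {E E' H H' M M' : Type*}
  [NormedAddCommGroup E] [NormedSpace ℝ E] [TopologicalSpace H]
  [NormedAddCommGroup E'] [NormedSpace ℝ E'] [TopologicalSpace H']
  {I : ModelWithCorners ℝ E H} {I' : ModelWithCorners ℝ E' H'}
  [TopologicalSpace M] [ChartedSpace H M] [TopologicalSpace M'] [ChartedSpace H' M']

variable (I) in
/-- `f` is a smooth primitive of the covector field `α` on a neighbourhood of `x`. -/
def IsPrimitiveNear (f : M → ℝ) (α : CovectorField I M) (x : M) : Prop :=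
  ∀ᶠ y in 𝓝 x, ContMDiffAt I 𝓘(ℝ, ℝ) ∞ f y ∧ HasMFDerivAt I 𝓘(ℝ, ℝ) f y (α y)

variable (I) in
/-- A covector field that has a smooth primitive near every point. By the Poincaré lemma, the
`1`-forms with this property are the closed ones. -/
def IsLocallyExact (α : CovectorField I M) : Prop :=
  ∀ x, ∃ f : M → ℝ, IsPrimitiveNear I f α x

namespace IsPrimitiveNear

variable {f g : M → ℝ} {α β : CovectorField I M} {x : M}

theorem contMDiffAt (hf : IsPrimitiveNear I f α x) : ContMDiffAt I 𝓘(ℝ, ℝ) ∞ f x :=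
  hf.self_of_nhds.1

theorem hasMFDerivAt (hf : IsPrimitiveNear I f α x) : HasMFDerivAt I 𝓘(ℝ, ℝ) f x (α x) :=
  hf.self_of_nhds.2

theorem congr (hf : IsPrimitiveNear I f α x) (hfg : g =ᶠ[𝓝 x] f) (hαβ : ∀ᶠ y in 𝓝 x, β y = α y) :
    IsPrimitiveNear I g β x := by
  filter_upwards [hf, hfg.eventuallyEq_nhds, hαβ] with y hy hgy hβ
  exact ⟨hy.1.congr_of_eventuallyEq hgy, hβ ▸ hy.2.congr_of_eventuallyEq hgy⟩

theorem add_const (hf : IsPrimitiveNear I f α x) (k : ℝ) :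
    IsPrimitiveNear I (fun y ↦ f y + k) α x := by
  filter_upwards [hf] with y hy
  have h := hy.2.add (hasMFDerivAt_const (I := I) (I' := 𝓘(ℝ, ℝ)) k y)
  exact ⟨hy.1.add contMDiffAt_const, (add_zero (α y : E →L[ℝ] ℝ)) ▸ h⟩

theorem sub (hf : IsPrimitiveNear I f α x) (hg : IsPrimitiveNear I g β x) :
    IsPrimitiveNear I (f - g) (α - β) x := by
  filter_upwards [hf, hg] with y hfy hgy
  exact ⟨hfy.1.sub hgy.1, hfy.2.sub hgy.2⟩

theorem sum {ι : Type} {s : Finset ι} {f : ι → M → ℝ} {α : ι → CovectorField I M}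
    (hf : ∀ i ∈ s, IsPrimitiveNear I (f i) (α i) x) :
    IsPrimitiveNear I (fun y ↦ ∑ i ∈ s, f i y) (fun y ↦ ∑ i ∈ s, α i y) x := by
  filter_upwards [(Filter.eventually_all_finset s).2 hf] with y hy
  refine ⟨contMDiffAt_finsetSum fun i hi ↦ (hy i hi).1, ?_⟩
  exact Finset.sum_fn s f ▸ HasMFDerivAt.sum fun i hi ↦ (hy i hi).2

theorem pullback {p : M → M'} {f : M' → ℝ} {β : CovectorField I' M'}
    (hf : IsPrimitiveNear I' f β (p x)) (hp : ∀ᶠ y in 𝓝 x, ContMDiffAt I I' ∞ p y) :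
    IsPrimitiveNear I (f ∘ p) (pullback I I' p β) x := by
  filter_upwards [hp.self_of_nhds.continuousAt.eventually hf, hp] with y hy hpy
  exact ⟨hy.1.comp y hpy, hy.2.comp y (hpy.mdifferentiableAt (by simp)).hasMFDerivAt⟩

theorem of_pullback {p : M → M'} (hp : IsLocalDiffeomorphAt I I' ∞ p x) {f : M' → ℝ}
    {β : CovectorField I' M'} (hf : IsPrimitiveNear I (f ∘ p) (DeRham.pullback I I' p β) x) :
    IsPrimitiveNear I' f β (p x) := by
  have hinv : hp.localInverse (p x) = x := hp.localInverse_left_inv hp.localInverse_mem_target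
  have hsource : ∀ᶠ y in 𝓝 (p x), y ∈ hp.localInverse.source :=
    hp.localInverse_open_source.mem_nhds hp.localInverse_mem_source
  have hsmooth : ∀ᶠ y in 𝓝 (p x), ContMDiffAt I' I ∞ hp.localInverse y := hsource.mono fun y hy ↦
    hp.contmdiffOn_localInverse.contMDiffAt (hp.localInverse_open_source.mem_nhds hy)
  have hnear : ∀ᶠ y in 𝓝 x, IsLocalDiffeomorphAt I I' ∞ p y :=
    let ⟨φ, hφ, heq⟩ := hp
    Filter.eventually_of_mem (φ.open_source.mem_nhds hφ) fun _ hy ↦ ⟨φ, hy, heq⟩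
  have hdiff := hp.localInverse_contMDiffAt.continuousAt.eventually (hinv.symm ▸ hnear)
  have hright := hp.localInverse_eventuallyEq_right
  refine ((hinv.symm ▸ hf).pullback hsmooth).congr (hright.fun_comp f).symm ?_
  filter_upwards [hright.eventuallyEq_nhds, hsmooth, hdiff] with y hy hsy hpy
  exact (pullback_pullback_of_eventuallyEq_id (hpy.mdifferentiableAt (by simp))
    (hsy.mdifferentiableAt (by simp)) hy β).symm

theorem eventually_eq_of_zero [I.Boundaryless] [IsManifold I ∞ M] (hf : IsPrimitiveNear I f 0 x) :
    ∀ᶠ y in 𝓝 x, f y = f x := by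
  let φ := extChartAt I x
  have hφ : IsPrimitiveNear 𝓘(ℝ, E) (f ∘ φ.symm) 0 (φ x) :=
    ((extChartAt_to_inv (I := I) x).symm ▸ hf).pullback <|
      (eventually_mem_nhds_iff.2 (extChartAt_target_mem_nhds x)).mono fun y hy ↦
        (contMDiffOn_extChartAt_symm x).contMDiffAt hy
  obtain ⟨r, hr, hball⟩ := Metric.eventually_nhds_iff_ball.1 hφ
  have hderiv : ∀ y ∈ Metric.ball (φ x) r, HasFDerivAt (f ∘ φ.symm) 0 y := fun y hy ↦
    (hball y hy).2.hasFDerivAt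
  filter_upwards [(continuousAt_extChartAt (I := I) x).eventually (Metric.ball_mem_nhds _ hr),
    extChartAt_source_mem_nhds (I := I) x] with y hy hy'
  have hconst := Metric.isOpen_ball.is_const_of_fderiv_eq_zero
    (convex_ball (φ x) r).isPreconnected
    (fun y hy ↦ (hderiv y hy).differentiableAt.differentiableWithinAt)
    (fun y hy ↦ (hderiv y hy).fderiv) hy (Metric.mem_ball_self hr)
  simpa only [Function.comp_apply, φ.left_inv hy', extChartAt_to_inv, φ] using hconst

theorem exists_eq_add_const_of_isPreconnected [I.Boundaryless] [IsManifold I ∞ M] {S : Set M}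
    (hS : IsPreconnected S) (hf : ∀ x ∈ S, IsPrimitiveNear I f α x)
    (hg : ∀ x ∈ S, IsPrimitiveNear I g α x) : ∃ k, ∀ x ∈ S, g x = f x + k := by
  rcases S.eq_empty_or_nonempty with rfl | ⟨x₀, hx₀⟩
  · exact ⟨0, by simp⟩
  have hlocal : ∀ x ∈ S, ∀ᶠ y in 𝓝[S] x, (g - f) y = (g - f) x := fun x hx ↦
    nhdsWithin_le_nhds (sub_self α ▸ (hg x hx).sub (hf x hx)).eventually_eq_of_zero
  refine ⟨g x₀ - f x₀, fun x hx ↦ ?_⟩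
  have hconst : (g - f) x = (g - f) x₀ :=
    hS.induction₂ (fun y z ↦ (g - f) z = (g - f) y) hlocal
      (fun _ _ _ _ _ _ hxy hyz ↦ hyz.trans hxy) (fun _ _ _ _ h ↦ h.symm) hx₀ hx
  rw [← Pi.sub_apply, ← hconst]
  simp

end IsPrimitiveNear

theorem mem_range_dZero_iff [IsManifold I ∞ M] {α : OneForm I M} :
    α ∈ LinearMap.range (dZero I M) ↔ ∃ f, ∀ x, IsPrimitiveNear I f α x := by
  refine ⟨?_, fun ⟨f, hf⟩ ↦ ⟨⟨f, fun x ↦ (hf x).contMDiffAt⟩, ?_⟩⟩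
  · rintro ⟨f, rfl⟩
    exact ⟨f, fun x ↦ .of_forall fun y ↦
      ⟨f.contMDiff y, ((f.contMDiff y).mdifferentiableAt (by simp)).hasMFDerivAt⟩⟩
  · ext x : 1
    exact (hf x).hasMFDerivAt.mfderiv

theorem IsLocallyExact.contMDiff [IsManifold I ∞ M] {α : CovectorField I M}
    (h : IsLocallyExact I α) :
    ContMDiff I (I.prod 𝓘(ℝ, E →L[ℝ] ℝ)) ∞ (fun x ↦ Bundle.TotalSpace.mk' (E →L[ℝ] ℝ)
      (E := fun x : M ↦ TangentSpace I x →L[ℝ] Bundle.Trivial M ℝ x) x (α x)) := by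
  intro x
  obtain ⟨f, hf⟩ := h x
  rw [contMDiffAt_hom_bundle]
  refine ⟨contMDiffAt_id,
    (hf.contMDiffAt.mfderiv_const (m := ∞) (by simp)).congr_of_eventuallyEq ?_⟩
  filter_upwards [hf] with y hy
  rw [show α y = mfderiv I 𝓘(ℝ, ℝ) f y from hy.2.mfderiv.symm]
  ext v
  simp only [inTangentCoordinates, ContinuousLinearMap.inCoordinates,
    Bundle.Trivial.fiberBundle_trivializationAt',
    Bundle.Trivial.continuousLinearMapAt_trivialization, ContinuousLinearMap.id_comp,
    TangentBundle.continuousLinearMapAt_model_space, id_eq]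
  rfl

theorem IsLocallyExact.of_pullback {p : M → M'} (hp : IsLocalDiffeomorph I I' ∞ p)
    (hsurj : Function.Surjective p) {β : CovectorField I' M'}
    (h : IsLocallyExact I (pullback I I' p β)) : IsLocallyExact I' β := by
  intro y
  obtain ⟨x, rfl⟩ := hsurj y
  obtain ⟨f, hf⟩ := h x
  refine ⟨f ∘ (hp x).localInverse, .of_pullback (hp x) (hf.congr ?_ (by simp))⟩
  exact (hp x).localInverse_eventuallyEq_left.fun_comp f

end LocallyExact

section Poincare
variable {E : Type*} [NormedAddCommGroup E] [NormedSpace ℝ E]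

theorem extDeriv_ofSubsingleton_apply {θ : E → E →L[ℝ] ℝ} {y : E} (hθ : DifferentiableAt ℝ θ y)
    (u v : E) :
    extDeriv (fun z ↦ ContinuousAlternatingMap.ofSubsingleton ℝ E ℝ (0 : Fin 1) (θ z)) y ![u, v] =
      fderiv ℝ θ y u v - fderiv ℝ θ y v u := by
  have hcomp := (ContinuousAlternatingMap.ofSubsingletonLIE (𝕜 := ℝ) (E := E) (F := ℝ)
    (0 : Fin 1)).hasFDerivAt.comp y hθ.hasFDerivAt
  have hfderiv : fderiv ℝ
      (fun z ↦ ContinuousAlternatingMap.ofSubsingleton ℝ E ℝ (0 : Fin 1) (θ z)) y = _ :=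
    hcomp.fderiv
  rw [extDeriv, hfderiv, ContinuousAlternatingMap.alternatizeUncurryFin_apply]
  simp [Fin.sum_univ_two, Fin.removeNth, sub_eq_add_neg]

theorem extDeriv_ofSubsingleton_eq_zero_of_isPrimitiveNear {g : E → ℝ} {θ : E → E →L[ℝ] ℝ} {y : E}
    (h : IsPrimitiveNear 𝓘(ℝ, E) g θ y) :
    extDeriv (fun z ↦ ContinuousAlternatingMap.ofSubsingleton ℝ E ℝ (0 : Fin 1) (θ z)) y = 0 := by
  have hdg : (fun z ↦ ContinuousAlternatingMap.ofSubsingleton ℝ E ℝ (0 : Fin 1) (θ z)) =ᶠ[𝓝 y]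
      extDeriv (fun z ↦ ContinuousAlternatingMap.constOfIsEmpty ℝ E (Fin 0) (g z)) := by
    filter_upwards [h] with z hz
    have hgz : HasFDerivAt g (θ z) z := hz.2.hasFDerivAt
    rw [extDeriv_constOfIsEmpty, hgz.fderiv]
  rw [hdg.extDeriv_eq]
  refine extDeriv_extDeriv_apply (r := ∞) ?_
    (by simpa using WithTop.coe_le_coe.2 (le_top : (2 : ℕ∞) ≤ ⊤))
  exact (ContinuousAlternatingMap.constOfIsEmptyLIE ℝ E ℝ (Fin 0)).contDiff.contDiffAt.comp _
    h.contMDiffAt.contDiffAt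

theorem exists_isPrimitiveNear_of_fderiv_symmetric {θ : E → E →L[ℝ] ℝ} {s : Set E}
    (hs : IsOpen s) (hconv : Convex ℝ s) (hθ : ContDiffOn ℝ ∞ θ s)
    (hsymm : ∀ y ∈ s, ∀ u v, fderiv ℝ θ y u v = fderiv ℝ θ y v u) :
    ∃ g : E → ℝ, ∀ y ∈ s, IsPrimitiveNear 𝓘(ℝ, E) g θ y := by
  obtain ⟨g, hg⟩ := hconv.exists_forall_hasFDerivAt_of_fderiv_symmetric hs
    (hθ.differentiableOn (by simp)) hsymm
  have hgsmooth : ContDiffOn ℝ ∞ g s := (contDiffOn_infty_iff_fderiv_of_isOpen hs).2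
    ⟨fun y hy ↦ (hg y hy).differentiableAt.differentiableWithinAt,
      hθ.congr fun y hy ↦ (hg y hy).fderiv⟩
  refine ⟨g, fun y hy ↦ ?_⟩
  filter_upwards [hs.mem_nhds hy] with z hz
  exact ⟨(hgsmooth.contDiffAt (hs.mem_nhds hz)).contMDiffAt, (hg z hz).hasMFDerivAt⟩

variable {H M : Type*} [TopologicalSpace H] {I : ModelWithCorners ℝ E H} [TopologicalSpace M]
  [ChartedSpace H M] [IsManifold I ∞ M] [I.Boundaryless]

theorem extDerivAt_eq_extDeriv (α : OneForm I M) (x : M) :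
    extDerivAt α x =
      extDeriv (fun y ↦ ContinuousAlternatingMap.ofSubsingleton ℝ E ℝ (0 : Fin 1) (localRep α x y))
        (extChartAt I x x) := by
  rw [extDerivAt, I.range_eq_univ, extDerivWithin_univ]

theorem localRep_eq_pullback (α : OneForm I M) (x : M) :
    localRep α x = pullback 𝓘(ℝ, E) I (extChartAt I x).symm α := by
  funext y
  rw [localRep, I.range_eq_univ, mfderivWithin_univ]
  rfl

theorem contMDiffAt_extChartAt_symm {x : M} {y : E}
    (hy : y ∈ (extChartAt I x).target) :
    ContMDiffAt 𝓘(ℝ, E) I ∞ (extChartAt I x).symm y :=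
  (contMDiffOn_extChartAt_symm x).contMDiffAt (extChartAt_target_mem_nhds' hy)

theorem pullback_extChartAt_localRep (α : OneForm I M) {x y : M}
    (hy : y ∈ (extChartAt I x).source) :
    pullback I 𝓘(ℝ, E) (extChartAt I x) (localRep α x) y = α y := by
  rw [localRep_eq_pullback]
  refine pullback_pullback_of_eventuallyEq_id
    ((contMDiffAt_extChartAt_symm ((extChartAt I x).map_source hy)).mdifferentiableAt (by simp))
    ((contMDiffAt_extChartAt' (n := ∞) (by simpa using hy)).mdifferentiableAt (by simp)) ?_ α
  filter_upwards [extChartAt_source_mem_nhds' hy] with z hz using (extChartAt I x).left_inv hz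

theorem localRep_eq_pullback_localRep (α : OneForm I M) (x x' : M) {y : E}
    (hy : y ∈ (extChartAt I x).target) (hy' : (extChartAt I x).symm y ∈ (extChartAt I x').source) :
    localRep α x y =
      pullback 𝓘(ℝ, E) 𝓘(ℝ, E) (extChartAt I x' ∘ (extChartAt I x).symm) (localRep α x') y := by
  have hs := contMDiffAt_extChartAt_symm hy
  have heq : (extChartAt I x').symm ∘ extChartAt I x' ∘ (extChartAt I x).symm =ᶠ[𝓝 y]
      (extChartAt I x).symm := by
    filter_upwards [hs.continuousAt.eventually (extChartAt_source_mem_nhds' hy')] with z hz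
      using (extChartAt I x').left_inv hz
  have hs' := contMDiffAt_extChartAt_symm ((extChartAt I x').map_source hy')
  have hτ := (contMDiffAt_extChartAt' (n := ∞) (by simpa using hy')).comp y hs
  rw [localRep_eq_pullback, localRep_eq_pullback, ← pullback_congr heq]
  exact pullback_comp (p := (extChartAt I x').symm) (q := extChartAt I x' ∘ (extChartAt I x).symm)
    (hs'.mdifferentiableAt (by simp)) (hτ.mdifferentiableAt (by simp)) α

theorem contDiffAt_localRep_extChartAt_self (α : OneForm I M) (x : M) :
    ContDiffAt ℝ ∞ (localRep α x) (extChartAt I x x) := by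
  have hsmooth := (contMDiffAt_iff.1 ((contMDiffAt_hom_bundle _).1 (α.contMDiff x)).2).2
  rw [I.range_eq_univ, contDiffWithinAt_univ] at hsmooth
  refine hsmooth.congr_of_eventuallyEq ?_
  filter_upwards [extChartAt_target_mem_nhds (I := I) x] with y hy
  have hy' := (extChartAt I x).map_target hy
  rw [extChartAt_source] at hy'
  simp only [Function.comp, extChartAt_model_space_eq_id, PartialEquiv.refl_coe, id]
  rw [ContinuousLinearMap.inCoordinates, TangentBundle.symmL_trivializationAt hy',
    (extChartAt I x).right_inv hy]
  ext v
  simp [localRep]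

theorem contDiffAt_extChartAt_comp_symm {x x' : M} {y : E} (hy : y ∈ (extChartAt I x).target)
    (hy' : (extChartAt I x).symm y ∈ (extChartAt I x').source) :
    ContDiffAt ℝ ∞ (extChartAt I x' ∘ (extChartAt I x).symm) y :=
  ((contMDiffAt_extChartAt' (by simpa using hy')).comp y
    (contMDiffAt_extChartAt_symm hy)).contDiffAt

theorem localRep_eventuallyEq (α : OneForm I M) {x x' : M} {y : E}
    (hy : y ∈ (extChartAt I x).target) (hy' : (extChartAt I x).symm y ∈ (extChartAt I x').source) :
    localRep α x =ᶠ[𝓝 y] fun z ↦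
      (localRep α x' ((extChartAt I x' ∘ (extChartAt I x).symm) z)).comp
        (fderiv ℝ (extChartAt I x' ∘ (extChartAt I x).symm) z) := by
  filter_upwards [(isOpen_extChartAt_target x).mem_nhds hy,
    (contMDiffAt_extChartAt_symm hy).continuousAt.eventually (extChartAt_source_mem_nhds' hy')]
    with z hz hz'
  rw [← mfderiv_eq_fderiv]
  exact localRep_eq_pullback_localRep α x x' hz hz'

theorem contDiffAt_localRep (α : OneForm I M) (x : M) {y : E} (hy : y ∈ (extChartAt I x).target) :
    ContDiffAt ℝ ∞ (localRep α x) y := by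
  have hx' := mem_extChartAt_source (I := I) ((extChartAt I x).symm y)
  have hτ := contDiffAt_extChartAt_comp_symm hy hx'
  refine ContDiffAt.congr_of_eventuallyEq ?_ (localRep_eventuallyEq α hy hx')
  exact ((contDiffAt_localRep_extChartAt_self α _).comp y hτ).clm_comp (hτ.fderiv_right (by simp))

theorem extDeriv_localRep_eq_zero {α : OneForm I M} (hα : dOne I M α = 0) (x : M) {y : E}
    (hy : y ∈ (extChartAt I x).target) :
    extDeriv (fun z ↦ ContinuousAlternatingMap.ofSubsingleton ℝ E ℝ (0 : Fin 1) (localRep α x z))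
      y = 0 := by
  let x' := (extChartAt I x).symm y
  have hx' : (extChartAt I x).symm y ∈ (extChartAt I x').source := mem_extChartAt_source x'
  have hclosed := (extDerivAt_eq_extDeriv α x').symm.trans (congrFun hα x')
  have hdiff := ofSubsingleton_differentiable α x'
  rw [I.range_eq_univ, differentiableWithinAt_univ] at hdiff
  have hpullback := extDeriv_pullback (x := y) (f := extChartAt I x' ∘ (extChartAt I x).symm)
    hdiff (contDiffAt_extChartAt_comp_symm hy hx')
    (by simpa using WithTop.coe_le_coe.2 (le_top : (2 : ℕ∞) ≤ ⊤))
  have hlocalRep := (localRep_eventuallyEq α hy hx').fun_comp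
    (ContinuousAlternatingMap.ofSubsingleton ℝ E ℝ (0 : Fin 1))
  refine hlocalRep.extDeriv_eq.trans (hpullback.trans ?_)
  rw [Function.comp_apply, hclosed]
  rfl

theorem fderiv_localRep_symmetric {α : OneForm I M} (hα : dOne I M α = 0) (x : M) {y : E}
    (hy : y ∈ (extChartAt I x).target) (u v : E) :
    fderiv ℝ (localRep α x) y u v = fderiv ℝ (localRep α x) y v u := by
  have hd := (contDiffAt_localRep α x hy).differentiableAt (by simp)
  rw [← sub_eq_zero, ← extDeriv_ofSubsingleton_apply hd, extDeriv_localRep_eq_zero hα x hy]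
  rfl

theorem dOne_eq_zero_iff_isLocallyExact {α : OneForm I M} :
    dOne I M α = 0 ↔ IsLocallyExact I α := by
  constructor
  · intro hα x
    obtain ⟨r, hr, hball⟩ := Metric.mem_nhds_iff.1 (extChartAt_target_mem_nhds (I := I) x)
    obtain ⟨g, hg⟩ := exists_isPrimitiveNear_of_fderiv_symmetric Metric.isOpen_ball
      (convex_ball (extChartAt I x x) r)
      (fun y hy ↦ (contDiffAt_localRep α x (hball hy)).contDiffWithinAt)
      (fun y hy ↦ fderiv_localRep_symmetric hα x (hball hy))
    have hsource := extChartAt_source_mem_nhds (I := I) x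
    refine ⟨g ∘ extChartAt I x, ((hg _ (Metric.mem_ball_self hr)).pullback ?_).congr .rfl ?_⟩
    · filter_upwards [hsource] with y hy using contMDiffAt_extChartAt' (by simpa using hy)
    · filter_upwards [hsource] with y hy using (pullback_extChartAt_localRep α hy).symm
  · intro hα
    funext x
    obtain ⟨f, hf⟩ := hα x
    have hsymm := ((extChartAt_to_inv (I := I) x).symm ▸ hf).pullback <|
      (eventually_mem_nhds_iff.2 (extChartAt_target_mem_nhds x)).mono fun y hy ↦
        (contMDiffAt_extChartAt_symm (mem_of_mem_nhds hy))
    exact (extDerivAt_eq_extDeriv α x).trans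
      (extDeriv_ofSubsingleton_eq_zero_of_isPrimitiveNear (localRep_eq_pullback α x ▸ hsymm))

theorem IsLocallyExact.exists_closedOneForm_eq {α : CovectorField I M} (h : IsLocallyExact I α) :
    ∃ η : ClosedOneForm I M, ∀ x, η.1 x = α x :=
  ⟨⟨⟨α, h.contMDiff⟩, dOne_eq_zero_iff_isLocallyExact.2 h⟩, fun _ ↦ rfl⟩

end Poincare

end DeRham

namespace Conf

section Quotient
variable {F G X Y K : Type*} [NormedAddCommGroup F] [NormedSpace ℝ F] [TopologicalSpace G]
  {J : ModelWithCorners ℝ F G} [TopologicalSpace X] [ChartedSpace G X]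

theorem isLocalDiffeomorphAt_of_smul [Group K] [MulAction K X]
    (hK : ∀ k : K, ContMDiff J J ∞ (fun x : X ↦ k • x)) [TopologicalSpace Y] [ChartedSpace G Y]
    {p : X → Y} (hpK : ∀ (k : K) x, p (k • x) = p x) {k : K} {x : X}
    (h : IsLocalDiffeomorphAt J J ∞ p (k • x)) : IsLocalDiffeomorphAt J J ∞ p x := by
  let translation : Diffeomorph J J X X ∞ :=
    { MulAction.toPerm k with
      contMDiff_toFun := hK k
      contMDiff_invFun := hK k⁻¹ }
  have hcomp : p ∘ translation = p := funext (hpK k)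
  exact hcomp ▸ (translation.isLocalDiffeomorph x).comp J Y h

/-- The charts of `Y` are by construction the inverses of `p` at the points of a section of `p`,
followed by charts of `X`: at these points `p` is therefore a transition between charts. -/
theorem isLocalDiffeomorphAt_section_of_isLocalHomeomorph [IsManifold J ∞ X] [TopologicalSpace Y]
    {p : X → Y} (hp : IsLocalHomeomorph p) (hsurj : Function.Surjective p)
    (hY : @IsManifold ℝ _ F _ _ G _ J ∞ Y _ (hp.chartedSpace hsurj)) (y : Y) :
    @IsLocalDiffeomorphAt ℝ _ F _ _ F _ _ G _ G _ J J X _ _ Y _ (hp.chartedSpace hsurj) ∞ p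
      (hsurj.hasRightInverse.choose y) := by
  let _ := hp.chartedSpace (H := G) hsurj
  let a := hsurj.hasRightInverse.choose y
  let e : OpenPartialHomeomorph X Y := (chartAt G a).trans (chartAt G y).symm
  have hchart : chartAt G y = (hp.localInverseAt a).trans (chartAt G a) := rfl
  refine ⟨⟨e.toPartialEquiv, e.open_source, e.open_target, ?_, ?_⟩, ?_, fun z hz ↦ ?_⟩
  · exact contMDiffOn_chart_symm.comp (contMDiffOn_chart.mono fun z hz ↦ hz.1) fun z hz ↦ hz.2
  · exact contMDiffOn_chart_symm.comp (contMDiffOn_chart.mono fun z hz ↦ hz.1) fun z hz ↦ hz.2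
  · refine ⟨mem_chart_source G a, ?_⟩
    change chartAt G a a ∈ (chartAt G y).target
    rw [hchart, OpenPartialHomeomorph.trans_target]
    simp
  · change p z = (chartAt G y).symm (chartAt G a z)
    simp [hchart, (chartAt G a).left_inv hz.1]

theorem isLocalDiffeomorph_of_isLocalHomeomorph_of_smul [IsManifold J ∞ X] [TopologicalSpace Y]
    [Group K] [MulAction K X] (hK : ∀ k : K, ContMDiff J J ∞ (fun x : X ↦ k • x)) {p : X → Y}
    (hp : IsLocalHomeomorph p) (hsurj : Function.Surjective p)
    (hpK : ∀ x y, p x = p y ↔ x ∈ MulAction.orbit K y) :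
    @IsLocalDiffeomorph ℝ _ F _ _ F _ _ G _ G _ J J X _ _ Y _ (hp.chartedSpace hsurj) ∞ p := by
  let _ := hp.chartedSpace (H := G) hsurj
  intro x
  obtain ⟨k, hk⟩ := (hpK _ x).1 (hsurj.hasRightInverse.choose_spec (p x))
  have hY := isManifold_quotient J hK hp hsurj hpK
  have hsection := isLocalDiffeomorphAt_section_of_isLocalHomeomorph hp hsurj hY (p x)
  exact isLocalDiffeomorphAt_of_smul hK (fun k x ↦ (hpK _ _).2 ⟨k, rfl⟩) (hk.symm ▸ hsection)

end Quotient

end Conf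

namespace DeRham

section Descent
variable {E E' H H' M M' : Type*} [NormedAddCommGroup E] [NormedSpace ℝ E] [TopologicalSpace H]
  [NormedAddCommGroup E'] [NormedSpace ℝ E'] [TopologicalSpace H']
  {I : ModelWithCorners ℝ E H} {I' : ModelWithCorners ℝ E' H'}
  [TopologicalSpace M] [ChartedSpace H M] [TopologicalSpace M'] [ChartedSpace H' M'] {p : M → M'}

theorem exists_comp_mfderiv_eq {x : M} (hp : IsLocalDiffeomorphAt I I' ∞ p x)
    (L : TangentSpace I x →L[ℝ] ℝ) :
    ∃ L' : TangentSpace I' (p x) →L[ℝ] ℝ, L'.comp (mfderiv I I' p x) = L := by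
  let D := hp.mfderivToContinuousLinearEquiv (by simp)
  exact ⟨L.comp D.symm.toContinuousLinearMap,
    ContinuousLinearMap.ext fun v ↦ congrArg L (D.symm_apply_apply v)⟩

theorem pullback_injective (hp : IsLocalDiffeomorph I I' ∞ p) (hsurj : Function.Surjective p) :
    Function.Injective (pullback I I' p) := by
  intro β γ h
  funext y
  obtain ⟨x, rfl⟩ := hsurj y
  let D := (hp x).mfderivToContinuousLinearEquiv (by simp)
  ext v
  obtain ⟨u, rfl⟩ := D.surjective v
  exact congrArg (· u) (congrFun h x)

/-- The covector at `p x` is determined by that at any point of the fibre, and the invariance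
makes the choice of the point irrelevant. -/
theorem exists_pullback_eq_of_smul {K : Type*} [Group K] [MulAction K M]
    (hK : ∀ k : K, MDifferentiable I I (fun x : M ↦ k • x)) (hp : IsLocalDiffeomorph I I' ∞ p)
    (hsurj : Function.Surjective p) (hpK : ∀ x y, p x = p y ↔ x ∈ MulAction.orbit K y)
    {α : CovectorField I M} (hα : ∀ k : K, pullback I I (fun x ↦ k • x) α = α) :
    ∃ β, pullback I I' p β = α := by
  have hinvariant : ∀ β (k : K) x, pullback I I' p β x =
      pullback I I (fun x ↦ k • x) (pullback I I' p β) x := by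
    intro β k x
    have hcomp : p ∘ (fun x ↦ k • x) = p := funext fun x ↦ (hpK _ _).2 ⟨k, rfl⟩
    rw [← pullback_comp ((hp _).mdifferentiableAt (by simp)) (hK k x), hcomp]
  choose L hL using fun x ↦ exists_comp_mfderiv_eq (hp x) (α x)
  let s := Function.surjInv hsurj
  have hs : ∀ y, p (s y) = y := Function.surjInv_eq hsurj
  -- All tangent spaces of `M'` are `E'`, which spares a transport along `p (s y) = y`.
  let L' : M → E' →L[ℝ] ℝ := L
  let β : CovectorField I' M' := fun y ↦ L' (s y)
  have hsection : ∀ y, pullback I I' p β (s y) = α (s y) := by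
    intro y
    have hβ : L' (s (p (s y))) = L' (s y) := congrArg (L' ∘ s) (hs y)
    exact (congrArg (fun A : E' →L[ℝ] ℝ ↦ A.comp (mfderiv I I' p (s y) : E →L[ℝ] E')) hβ).trans
      (hL (s y))
  refine ⟨β, funext fun x ↦ ?_⟩
  obtain ⟨k, hk⟩ : ∃ k : K, k • x = s (p x) := (hpK _ x).1 (hs (p x))
  have hx : pullback I I' p β (k • x) = α (k • x) := hk ▸ hsection (p x)
  rw [hinvariant β k, ← congrFun (hα k) x, pullback, hx]
  rfl

end Descent
end DeRham

namespace Conf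
open DeRham

section OrderedTuples
variable {ι E N : Type*} [NormedAddCommGroup E] [NormedSpace ℝ E] {ℓ : E →L[ℝ] ℝ}
  [TopologicalSpace N]

theorem eventually_injective_add_mul [Finite ι] (a : ι → ℝ) {c : ι → ℝ}
    (hc : Function.Injective c) :
    ∀ᶠ t in 𝓝[≠] (0 : ℝ), Function.Injective fun i ↦ a i + t * c i := by
  have hpair : ∀ᶠ t in 𝓝[≠] (0 : ℝ), ∀ i j, t ≠ (a j - a i) / (c i - c j) :=
    Filter.eventually_all.2 fun i ↦ Filter.eventually_all.2 fun j ↦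
      nhdsNE_le_cofinite 0 (Filter.eventually_cofinite_ne _)
  filter_upwards [hpair] with t ht i j hij
  by_contra hne
  refine ht i j ((eq_div_iff (sub_ne_zero.2 (hc.ne hne))).2 ?_)
  linarith

theorem dense_setOf_injective_comp [Finite ι] (hℓ : ℓ ≠ 0) :
    Dense {y : ι → E | Function.Injective (ℓ ∘ y)} := by
  intro y
  obtain ⟨v, hv⟩ : ∃ v, ℓ v ≠ 0 := by
    by_contra! h
    exact hℓ (ContinuousLinearMap.ext h)
  obtain ⟨c, hc⟩ := Countable.exists_injective_nat ι
  have hcv : Function.Injective fun i ↦ c i * ℓ v :=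
    fun i j hij ↦ hc (Nat.cast_injective (mul_right_cancel₀ hv hij))
  have hlim : Filter.Tendsto (fun (t : ℝ) i ↦ y i + t • (c i : ℝ) • v) (𝓝[≠] 0) (𝓝 y) := by
    have hcont : Continuous fun (t : ℝ) i ↦ y i + t • (c i : ℝ) • v := by fun_prop
    simpa using (hcont.tendsto 0).mono_left nhdsWithin_le_nhds
  refine mem_closure_of_tendsto hlim ?_
  filter_upwards [eventually_injective_add_mul (ℓ ∘ y) hcv] with t ht
  simpa [Function.comp_def] using ht

theorem mem_closure_setOf_injective_comp_chart [Finite ι] (e : OpenPartialHomeomorph N E)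
    (hℓ : ℓ ≠ 0) {a : ι → N} (ha : ∀ i, a i ∈ e.source) :
    a ∈ closure {w : ι → N | (∀ i, w i ∈ e.source) ∧ Function.Injective fun i ↦ ℓ (e (w i))} := by
  have _ := Fintype.ofFinite ι
  let target : Set (ι → E) := Set.univ.pi fun _ ↦ e.target
  have htarget : IsOpen target := isOpen_set_pi Set.finite_univ fun _ _ ↦ e.open_target
  have hea : (fun i ↦ e (a i)) ∈ target := fun i _ ↦ e.map_source (ha i)
  have hcont : ContinuousAt (fun (y : ι → E) i ↦ e.symm (y i)) fun i ↦ e (a i) :=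
    continuousAt_pi.2 fun i ↦
      (e.continuousAt_symm (hea i trivial)).comp (f := fun y : ι → E ↦ y i)
        (continuous_apply i).continuousAt
  have hsymm : (fun i ↦ e.symm (e (a i))) = a := funext fun i ↦ e.left_inv (ha i)
  rw [← hsymm]
  refine hcont.continuousWithinAt.mem_closure
    ((dense_setOf_injective_comp hℓ).open_subset_closure_inter htarget hea) fun y hy ↦ ?_
  refine ⟨fun i ↦ e.map_target (hy.1 i trivial), ?_⟩
  have hinj : Function.Injective fun i ↦ ℓ (y i) := hy.2
  simpa only [e.right_inv (hy.1 _ trivial)] using hinj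

theorem mem_closure_setOf_injective [Finite ι] [Nontrivial E] (e : OpenPartialHomeomorph N E)
    {a : ι → N} (ha : ∀ i, a i ∈ e.source) :
    a ∈ closure {w : ι → N | Function.Injective w} := by
  obtain ⟨ℓ, hℓ⟩ := exists_ne (0 : E →L[ℝ] ℝ)
  exact closure_mono (fun w hw ↦ .of_comp (f := fun y ↦ ℓ (e y)) hw.2)
    (mem_closure_setOf_injective_comp_chart e hℓ ha)

/-- The tuples of points of `b` whose values under `ℓ` are strictly increasing. -/
def orderedTuples (ι : Type*) [Preorder ι] (ℓ : E →L[ℝ] ℝ) (b : Set E) : Set (ι → E) :=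
  {y | (∀ i, y i ∈ b) ∧ StrictMono (ℓ ∘ y)}

theorem convex_orderedTuples [Preorder ι] {b : Set E} (hb : Convex ℝ b) :
    Convex ℝ (orderedTuples ι ℓ b) := by
  intro y hy y' hy' s t hs ht hst
  refine ⟨fun i ↦ hb (hy.1 i) (hy'.1 i) hs ht hst, fun i j hij ↦ sub_pos.1 ?_⟩
  have hpos := convex_Ioi (0 : ℝ) (sub_pos.2 (hy.2 hij)) (sub_pos.2 (hy'.2 hij)) hs ht hst
  simp only [Set.mem_Ioi, Function.comp_apply, smul_eq_mul] at hpos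
  simp only [Function.comp_apply, Pi.add_apply, Pi.smul_apply, map_add, map_smul, smul_eq_mul]
  linarith

theorem exists_openPartialHomeomorph_convex_target [ChartedSpace E N] {x : N} {U : Set N}
    (hU : U ∈ 𝓝 x) : ∃ e : OpenPartialHomeomorph N E,
      x ∈ e.source ∧ e.source ⊆ U ∧ Convex ℝ e.target := by
  let c := chartAt E x
  have hsymm : c.target ∩ c.symm ⁻¹' U ∈ 𝓝 (c x) :=
    Filter.inter_mem (c.open_target.mem_nhds (mem_chart_target E x))
      ((c.tendsto_symm (mem_chart_source E x)) hU)
  obtain ⟨r, hr, hball⟩ := Metric.mem_nhds_iff.1 hsymm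
  let e := (c.symm.restrOpen (Metric.ball (c x) r) Metric.isOpen_ball).symm
  have htarget : e.target = Metric.ball (c x) r :=
    Set.inter_eq_right.2 fun y hy ↦ (hball hy).1
  refine ⟨e, ⟨mem_chart_source E x, Metric.mem_ball_self hr⟩, fun y hy ↦ ?_,
    htarget ▸ convex_ball _ _⟩
  have hy' : c.symm (c y) ∈ U := (hball hy.2).2
  rwa [c.left_inv hy.1] at hy'

end OrderedTuples

section SymmetricSums
variable {m : ℕ} {N : Type*} [TopologicalSpace N] [T2Space N]
  {E : Type*} [NormedAddCommGroup E] [NormedSpace ℝ E]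

theorem proj_surjective : Function.Surjective (proj : OrdConf m N → UConf m N) :=
  Quotient.mk_surjective

theorem proj_eq_proj_iff {x y : OrdConf m N} :
    proj x = proj y ↔ x ∈ MulAction.orbit (Equiv.Perm (Fin m)) y :=
  Quotient.eq''

theorem proj_smul (σ : Equiv.Perm (Fin m)) (x : OrdConf m N) : proj (σ • x) = proj x :=
  proj_eq_proj_iff.2 ⟨σ, rfl⟩

/-- The function on unordered configurations obtained by summing `f` over the points. -/
def symSum (f : N → ℝ) : UConf m N → ℝ :=
  Quotient.lift (fun x : OrdConf m N ↦ ∑ i, f (x.1 i)) <| by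
    rintro _ y ⟨σ, rfl⟩
    exact Equiv.sum_comp σ⁻¹ fun i ↦ f (y.1 i)

theorem symSum_proj (f : N → ℝ) (x : OrdConf m N) : symSum f (proj x) = ∑ i, f (x.1 i) := rfl

variable [ChartedSpace E N] [IsManifold 𝓘(ℝ, E) ∞ N] {α : OneForm 𝓘(ℝ, E) N}

theorem contMDiff_coord (i : Fin m) :
    ContMDiff (piModel (Fin m) E) 𝓘(ℝ, E) ∞ (fun x : OrdConf m N ↦ x.1 i) :=
  (contMDiff_eval i).comp contMDiff_subtype_val

theorem hat_eq_sum_pullback (α : OneForm 𝓘(ℝ, E) N) (x : OrdConf m N) :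
    hat α x = ∑ i, pullback (piModel (Fin m) E) 𝓘(ℝ, E) (fun z : OrdConf m N ↦ z.1 i) α x :=
  rfl

theorem hat_add (α β : OneForm 𝓘(ℝ, E) N) (x : OrdConf m N) :
    hat (α + β) x = hat α x + hat β x :=
  (Finset.sum_congr rfl fun _ _ ↦ ContinuousLinearMap.add_comp _ _ _).trans
    Finset.sum_add_distrib

theorem hat_smul (r : ℝ) (α : OneForm 𝓘(ℝ, E) N) (x : OrdConf m N) :
    hat (r • α) x = r • hat α x :=
  (Finset.sum_congr rfl fun _ _ ↦ ContinuousLinearMap.smul_comp _ _ _).trans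
    Finset.smul_sum.symm

theorem pullback_smul_hat (α : OneForm 𝓘(ℝ, E) N) (σ : Equiv.Perm (Fin m)) :
    pullback (piModel (Fin m) E) (piModel (Fin m) E) (fun x : OrdConf m N ↦ σ • x) (hat α) =
      hat α := by
  funext x
  have hcoord : ∀ i,
      pullback (piModel (Fin m) E) 𝓘(ℝ, E) (fun z : OrdConf m N ↦ z.1 (σ⁻¹ i)) α x =
      pullback (piModel (Fin m) E) (piModel (Fin m) E) (fun z : OrdConf m N ↦ σ • z)
        (pullback (piModel (Fin m) E) 𝓘(ℝ, E) (fun z : OrdConf m N ↦ z.1 i) α) x := fun i ↦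
    pullback_comp ((contMDiff_coord i (σ • x)).mdifferentiableAt (by simp))
      ((contMDiff_smul σ x).mdifferentiableAt (by simp)) α
  rw [hat_eq_sum_pullback, ← Equiv.sum_comp σ⁻¹, Finset.sum_congr rfl fun i _ ↦ hcoord i]
  exact ContinuousLinearMap.finsetSum_comp _ _

theorem isPrimitiveNear_hat {f : Fin m → N → ℝ} {x : OrdConf m N}
    (hf : ∀ i, IsPrimitiveNear 𝓘(ℝ, E) (f i) α (x.1 i)) :
    IsPrimitiveNear (piModel (Fin m) E) (fun z ↦ ∑ i, f i (z.1 i)) (hat α) x :=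
  .sum fun i _ ↦ (hf i).pullback (p := fun z : OrdConf m N ↦ z.1 i)
    (.of_forall (contMDiff_coord i))

theorem isLocallyExact_hat (hα : IsLocallyExact 𝓘(ℝ, E) α) :
    IsLocallyExact (piModel (Fin m) E) (hat α : CovectorField (piModel (Fin m) E) (OrdConf m N)) :=
  fun x ↦
    let ⟨_, hf⟩ := Classical.axiomOfChoice fun i ↦ hα (x.1 i)
    ⟨_, isPrimitiveNear_hat hf⟩

variable [FiniteDimensional ℝ E]

theorem isLocalDiffeomorph_proj :
    IsLocalDiffeomorph (piModel (Fin m) E) (piModel (Fin m) E) ∞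
      (proj : OrdConf m N → UConf m N) :=
  haveI := locallyCompactSpace_ordConf (m := m) E N
  isLocalDiffeomorph_of_isLocalHomeomorph_of_smul contMDiff_smul
    isQuotientCoveringMap_quotientMk_of_properlyDiscontinuousSMul.isCoveringMap.isLocalHomeomorph
    proj_surjective fun _ _ ↦ proj_eq_proj_iff

theorem pullProj_injective {η θ : OneForm (piModel (Fin m) E) (UConf m N)}
    (h : ∀ x : OrdConf m N, pullProj η x = pullProj θ x) : η = θ :=
  ContMDiffSection.ext fun q ↦
    congrFun (pullback_injective isLocalDiffeomorph_proj proj_surjective (funext h)) q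

theorem exists_closedOneForm_pullProj_eq_hat (α : ClosedOneForm 𝓘(ℝ, E) N) :
    ∃ η : ClosedOneForm (piModel (Fin m) E) (UConf m N),
      ∀ x : OrdConf m N, pullProj η.1 x = hat α.1 x := by
  have hα : IsLocallyExact 𝓘(ℝ, E) α.1 :=
    dOne_eq_zero_iff_isLocallyExact.1 (LinearMap.mem_ker.1 α.2)
  obtain ⟨β, hβ⟩ := exists_pullback_eq_of_smul
    (fun σ ↦ (contMDiff_smul σ).mdifferentiable (by simp)) isLocalDiffeomorph_proj proj_surjective
    (fun _ _ ↦ proj_eq_proj_iff) (pullback_smul_hat (m := m) α.1)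
  have hexact : IsLocallyExact (piModel (Fin m) E) β :=
    .of_pullback isLocalDiffeomorph_proj proj_surjective (hβ ▸ isLocallyExact_hat hα)
  obtain ⟨η, hη⟩ := hexact.exists_closedOneForm_eq
  obtain rfl : η.1 = β := funext hη
  exact ⟨η, congrFun hβ⟩

variable (m N E) in
/-- The linear map sending a closed form `α` to the unique form on the unordered configuration space
whose pullback is `hat α`. -/
def descendClosed :
    ClosedOneForm 𝓘(ℝ, E) N →ₗ[ℝ] ClosedOneForm (piModel (Fin m) E) (UConf m N) where
  toFun α := (exists_closedOneForm_pullProj_eq_hat α).choose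
  map_add' α β := Subtype.ext <| pullProj_injective fun x ↦ by
    have hη := fun α : ClosedOneForm 𝓘(ℝ, E) N ↦
      (exists_closedOneForm_pullProj_eq_hat (m := m) α).choose_spec x
    rw [hη, Submodule.coe_add, hat_add, ← hη α, ← hη β]
    rfl
  map_smul' r α := Subtype.ext <| pullProj_injective fun x ↦ by
    have hη := fun α : ClosedOneForm 𝓘(ℝ, E) N ↦
      (exists_closedOneForm_pullProj_eq_hat (m := m) α).choose_spec x
    rw [hη, Submodule.coe_smul, hat_smul, ← hη α]
    rfl

theorem pullProj_descendClosed (α : ClosedOneForm 𝓘(ℝ, E) N) (x : OrdConf m N) :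
    pullProj (descendClosed m N E α).1 x = hat α.1 x :=
  (exists_closedOneForm_pullProj_eq_hat α).choose_spec x

theorem isPrimitiveNear_symSum {η : OneForm (piModel (Fin m) E) (UConf m N)}
    (hη : ∀ x : OrdConf m N, pullProj η x = hat α x) {f : N → ℝ} {x : OrdConf m N}
    (hf : ∀ i, IsPrimitiveNear 𝓘(ℝ, E) f α (x.1 i)) :
    IsPrimitiveNear (piModel (Fin m) E) (symSum f) η (proj x) :=
  .of_pullback (isLocalDiffeomorph_proj x) ((isPrimitiveNear_hat hf).congr .rfl (.of_forall hη))

theorem mem_range_dZero_of_pullProj_eq_hat {η : OneForm (piModel (Fin m) E) (UConf m N)}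
    (hη : ∀ x : OrdConf m N, pullProj η x = hat α x)
    (hα : α ∈ LinearMap.range (dZero 𝓘(ℝ, E) N)) :
    η ∈ LinearMap.range (dZero (piModel (Fin m) E) (UConf m N)) := by
  obtain ⟨f, hf⟩ := mem_range_dZero_iff.1 hα
  refine mem_range_dZero_iff.2 ⟨symSum f, fun q ↦ ?_⟩
  obtain ⟨x, rfl⟩ := proj_surjective q
  exact isPrimitiveNear_symSum hη fun i ↦ hf (x.1 i)

end SymmetricSums

section ConnectedConfigurations
variable {m : ℕ} {N E : Type*} [TopologicalSpace N] [T2Space N] [NormedAddCommGroup E]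
  [NormedSpace ℝ E]

/-- The unordered configurations of points of `U`. -/
def confIn (m : ℕ) (U : Set N) : Set (UConf m N) :=
  proj '' {x | ∀ i, x.1 i ∈ U}

theorem confIn_mono {U V : Set N} (h : U ⊆ V) : confIn m U ⊆ confIn m V :=
  Set.image_mono fun _ hx i ↦ h (hx i)

/-- The ordered configurations in the domain of the chart `e` whose coordinates are strictly
increasing along `ℓ`: the preferred orderings of the configurations whose points are separated by
`ℓ`. -/
def sortedConf (m : ℕ) (e : OpenPartialHomeomorph N E) (ℓ : E →L[ℝ] ℝ) : Set (OrdConf m N) :=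
  {x | (∀ i, x.1 i ∈ e.source) ∧ (fun i ↦ e (x.1 i)) ∈ orderedTuples (Fin m) ℓ e.target}

theorem exists_mem_sortedConf_proj_eq (e : OpenPartialHomeomorph N E) {ℓ : E →L[ℝ] ℝ}
    {x : OrdConf m N} (hx : ∀ i, x.1 i ∈ e.source)
    (hinj : Function.Injective fun i ↦ ℓ (e (x.1 i))) :
    ∃ z ∈ sortedConf m e ℓ, proj z = proj x := by
  let σ := Tuple.sort fun i ↦ ℓ (e (x.1 i))
  refine ⟨σ⁻¹ • x, ⟨fun i ↦ hx _, fun i ↦ e.map_source (hx _), ?_⟩, proj_smul _ _⟩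
  exact (Tuple.monotone_sort fun i ↦ ℓ (e (x.1 i))).strictMono_of_injective
    (hinj.comp σ.injective)

theorem confIn_source_subset_closure_image_sortedConf (e : OpenPartialHomeomorph N E)
    {ℓ : E →L[ℝ] ℝ} (hℓ : ℓ ≠ 0) :
    confIn m e.source ⊆ closure (proj '' sortedConf m e ℓ) := by
  let separated : Set (OrdConf m N) :=
    {x | (∀ i, x.1 i ∈ e.source) ∧ Function.Injective fun i ↦ ℓ (e (x.1 i))}
  have hdense : {x : OrdConf m N | ∀ i, x.1 i ∈ e.source} ⊆ closure separated := fun x hx ↦ by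
    refine closure_subtype.2 (closure_mono (fun w hw ↦ ?_)
      (mem_closure_setOf_injective_comp_chart e hℓ hx))
    exact ⟨⟨w, .of_comp (f := fun y ↦ ℓ (e y)) hw.2⟩, hw, rfl⟩
  refine (Set.image_mono hdense).trans <|
    (image_closure_subset_closure_image continuous_quotient_mk').trans <| closure_mono ?_
  rintro _ ⟨x, hx, rfl⟩
  exact exists_mem_sortedConf_proj_eq e hx.1 hx.2

theorem isPreconnected_sortedConf (e : OpenPartialHomeomorph N E) (he : Convex ℝ e.target)
    (ℓ : E →L[ℝ] ℝ) : IsPreconnected (sortedConf m e ℓ) := by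
  have hinj (y : orderedTuples (Fin m) ℓ e.target) :
      Function.Injective fun i ↦ e.symm (y.1 i) := fun i j hij ↦
    y.2.2.injective (congrArg ℓ (e.symm.injOn (y.2.1 i) (y.2.1 j) hij))
  let tuple (y : orderedTuples (Fin m) ℓ e.target) : OrdConf m N := ⟨_, hinj y⟩
  have htuple : Continuous tuple := .subtype_mk (continuous_pi fun i ↦
    e.continuousOn_symm.comp_continuous ((continuous_apply i).comp continuous_subtype_val)
      fun y ↦ y.2.1 i) _
  have := Subtype.preconnectedSpace
    (convex_orderedTuples (ι := Fin m) (ℓ := ℓ) he).isPreconnected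
  convert isPreconnected_range htuple using 1
  refine Set.Subset.antisymm (fun x hx ↦ ⟨⟨_, hx.2⟩, ?_⟩) ?_
  · exact Subtype.ext (funext fun i ↦ e.left_inv (hx.1 i))
  · rintro _ ⟨y, rfl⟩
    have hy : (fun i ↦ e (e.symm (y.1 i))) = y.1 := funext fun i ↦ e.right_inv (y.2.1 i)
    exact ⟨fun i ↦ e.map_target (y.2.1 i), hy ▸ y.2⟩

theorem isPreconnected_confIn_source [Nontrivial E] (e : OpenPartialHomeomorph N E)
    (he : Convex ℝ e.target) : IsPreconnected (confIn m e.source) := by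
  obtain ⟨ℓ, hℓ⟩ := exists_ne (0 : E →L[ℝ] ℝ)
  exact ((isPreconnected_sortedConf e he ℓ).image _ continuous_quotient_mk'.continuousOn)
    |>.subset_closure (Set.image_mono fun _ hx ↦ hx.1)
      (confIn_source_subset_closure_image_sortedConf e hℓ)

end ConnectedConfigurations

section Injectivity
variable {m : ℕ} {N : Type*} [TopologicalSpace N] [T2Space N]

theorem eq_of_eqOn_confIn (hm : m ≠ 0) {f g : N → ℝ} {y : N} {U : Set N} (hU : U ∈ 𝓝 y)
    (hy : (fun _ ↦ y) ∈ closure {w : Fin m → N | Function.Injective w})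
    (hf : ContinuousAt f y) (hg : ContinuousAt g y)
    (hfg : Set.EqOn (symSum f) (symSum g) (confIn m U)) : f y = g y := by
  let diag : Fin m → N := fun _ ↦ y
  have hlim {f : N → ℝ} (hf : ContinuousAt f y) :
      Filter.Tendsto (fun w : Fin m → N ↦ ∑ i, f (w i)) (𝓝 diag) (𝓝 (m * f y)) := by
    simpa using tendsto_finsetSum Finset.univ fun i _ ↦
      hf.tendsto.comp ((continuous_apply i).tendsto diag)
  have hnear : ∀ᶠ w in 𝓝 diag, ∀ i, w i ∈ U :=
    Filter.eventually_all.2 fun i ↦ (continuous_apply i).tendsto diag hU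
  have hsum : ∃ᶠ w in 𝓝 diag, ∑ i, f (w i) = ∑ i, g (w i) :=
    ((mem_closure_iff_frequently.1 hy).and_eventually hnear).mono fun w hw ↦
      hfg ⟨⟨w, hw.1⟩, hw.2, rfl⟩
  exact mul_left_cancel₀ (Nat.cast_ne_zero.2 hm)
    (tendsto_nhds_unique_of_frequently_eq (hlim hf) (hlim hg) hsum)

variable {E : Type*} [NormedAddCommGroup E] [NormedSpace ℝ E] [Nontrivial E]
  [FiniteDimensional ℝ E] [ChartedSpace E N] [IsManifold 𝓘(ℝ, E) ∞ N] {α : OneForm 𝓘(ℝ, E) N}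
  {η : OneForm (piModel (Fin m) E) (UConf m N)}

theorem exists_eqOn_symSum (hm : m ≠ 0) (hη : ∀ x : OrdConf m N, pullProj η x = hat α x)
    (hα : IsLocallyExact 𝓘(ℝ, E) α) {g : UConf m N → ℝ}
    (hg : ∀ q, IsPrimitiveNear (piModel (Fin m) E) g η q) (x : N) :
    ∃ U ∈ 𝓝 x, ∃ f : N → ℝ, (∀ y ∈ U, IsPrimitiveNear 𝓘(ℝ, E) f α y) ∧
      Set.EqOn g (symSum f) (confIn m U) := by
  obtain ⟨f, hf⟩ := hα x
  obtain ⟨e, hxe, heU, he⟩ := exists_openPartialHomeomorph_convex_target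
    (E := E) (U := {y | IsPrimitiveNear 𝓘(ℝ, E) f α y}) (eventually_eventually_nhds.2 hf)
  have hsum : ∀ q ∈ confIn m e.source,
      IsPrimitiveNear (piModel (Fin m) E) (symSum f) η q := by
    rintro _ ⟨z, hz, rfl⟩
    exact isPrimitiveNear_symSum hη fun i ↦ heU (hz i)
  obtain ⟨k, hk⟩ := IsPrimitiveNear.exists_eq_add_const_of_isPreconnected
    (isPreconnected_confIn_source e he) hsum fun q _ ↦ hg q
  refine ⟨e.source, e.open_source.mem_nhds hxe, fun y ↦ f y + k / m,
    fun y hy ↦ (heU hy).add_const _, ?_⟩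
  rintro _ ⟨z, hz, rfl⟩
  rw [hk _ ⟨z, hz, rfl⟩, symSum_proj, symSum_proj, Finset.sum_add_distrib, Finset.sum_const,
    Finset.card_univ, Fintype.card_fin, nsmul_eq_mul, mul_div_cancel₀ k (Nat.cast_ne_zero.2 hm)]

theorem mem_range_dZero_of_hat_eq_pullProj (hm : m ≠ 0)
    (hη : ∀ x : OrdConf m N, pullProj η x = hat α x) (hα : IsLocallyExact 𝓘(ℝ, E) α)
    (hη' : η ∈ LinearMap.range (dZero (piModel (Fin m) E) (UConf m N))) :
    α ∈ LinearMap.range (dZero 𝓘(ℝ, E) N) := by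
  obtain ⟨g, hg⟩ := mem_range_dZero_iff.1 hη'
  choose U hU f hf hgf using exists_eqOn_symSum hm hη hα hg
  have hdiag {x y : N} (hy : U x ∈ 𝓝 y) :
      f y y = f x y :=
    eq_of_eqOn_confIn hm (Filter.inter_mem (hU y) hy)
      (mem_closure_setOf_injective (chartAt E y) fun _ ↦ mem_chart_source E y)
      (hf y y (mem_of_mem_nhds (hU y))).contMDiffAt.continuousAt
      (hf x y (mem_of_mem_nhds hy)).contMDiffAt.continuousAt
      (((hgf y).mono (confIn_mono Set.inter_subset_left)).symm.trans
        ((hgf x).mono (confIn_mono Set.inter_subset_right)))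
  refine mem_range_dZero_iff.2 ⟨fun y ↦ f y y, fun x ↦ ?_⟩
  refine (hf x x (mem_of_mem_nhds (hU x))).congr ?_ (.of_forall fun _ ↦ rfl)
  filter_upwards [eventually_mem_nhds_iff.2 (hU x)] with y hy using hdiag hy

end Injectivity

end Conf
end

theorem mainTheorem3 {E : Type*} [NormedAddCommGroup E] [NormedSpace ℝ E] [FiniteDimensional ℝ E]
    (hE : 1 ≤ Module.finrank ℝ E)
    {N : Type*} [TopologicalSpace N] [T2Space N] [ChartedSpace E N] [IsManifold 𝓘(ℝ, E) ∞ N]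
    (m : ℕ) (hm : 1 ≤ m) :
    ∃ Φ : DeRham.H1 𝓘(ℝ, E) N →ₗ[ℝ] DeRham.H1 (Conf.piModel (Fin m) E) (Conf.UConf m N),
      Function.Injective Φ ∧
      ∀ α : DeRham.ClosedOneForm 𝓘(ℝ, E) N,
        ∃ η : DeRham.ClosedOneForm (Conf.piModel (Fin m) E) (Conf.UConf m N),
          (∀ x : Conf.OrdConf m N, Conf.pullProj η.1 x = Conf.hat α.1 x) ∧
          Φ (DeRham.H1.mk α) = DeRham.H1.mk η := by
  have : Nontrivial E := Module.nontrivial_of_finrank_pos (R := ℝ) hE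
  refine ⟨Submodule.mapQ _ _ (Conf.descendClosed m N E) fun α hα ↦
    Conf.mem_range_dZero_of_pullProj_eq_hat (Conf.pullProj_descendClosed α) hα, ?_, fun α ↦
    ⟨Conf.descendClosed m N E α, Conf.pullProj_descendClosed α, rfl⟩⟩
  rw [injective_iff_map_eq_zero]
  intro a ha
  obtain ⟨α, rfl⟩ := Submodule.mkQ_surjective _ a
  have hη : Conf.descendClosed m N E α ∈ Submodule.submoduleOf _ _ :=
    (Submodule.Quotient.mk_eq_zero _).1 ha
  have hα : DeRham.IsLocallyExact 𝓘(ℝ, E) α.1 :=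
    DeRham.dOne_eq_zero_iff_isLocallyExact.1 (LinearMap.mem_ker.1 α.2)
  exact (Submodule.Quotient.mk_eq_zero _).2
    (Conf.mem_range_dZero_of_hat_eq_pullProj (by omega) (Conf.pullProj_descendClosed α) hα hη)
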